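/- For an integer $k\ge 1$ let $b_k(n)$ denote the number of partitions of $n$ in which no part is a multiple of $k$, with $b_k(0)=1$ and $b_k(n)=0$ for negative integers $n$. **Theorem.** If $l$ is a prime with $l\equiv 13, 17, 19$ or $23 \pmod{24}$, then $$b_4\!\left(3l(ln+j)+\frac{l^2-1}{8}\right)\equiv 0 \pmod 3$$ and $$b_4\!\left(3l(ln+j)+\frac{9l^2-1}{8}\right)\equiv 0 \pmod 3$$ for every integer $n$ and every integer $j$ with $1\le j\le l-1$. -/

import Mathlib

/-- The number `b_k(n)` of `k`-regular partitions of `n`, that is, partitions of `n` in which no part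
is a multiple of `k`, with the convention that `b_k(n) = 0` for negative `n`.
(The empty partition gives `b_k(0) = 1`.) -/
def regularPartitionCount (k : ℕ) (n : ℤ) : ℕ :=
  if 0 ≤ n then (Nat.Partition.restricted n.toNat (fun i => ¬ k ∣ i)).card else 0

open PowerSeries PowerSeries.WithPiTopology Filter Topology

/-! Write φ(q) for `thetaSeries X X`, ψ(-q) for `thetaSeries (-X) (-X ^ 3)`, and D_d, E_d for
`distinctProd` and `eulerProd`. The generating function of b_4 is D_1 D_2.

Modulo 3, φ(q)^4 = φ(q) φ(q^3) counts representations by x² + 3y². For even n > 0 their number is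
divisible by 3, because a cube root of unity acts on them without fixed points. Hence φ(q)^4 +
φ(-q)^4 ≡ -1 (`thetaSeries_pow_four_add`). Multiplying by D_1 D_2 and using the Jacobi triple
product gives D_1 D_2 ≡ -φ(-q)^3 ψ(-q) - (φ(q) D_1)^3 φ(-q²) (`distinctProd_mul_distinctProd_two`).

A nonzero coefficient at q^m in the first summand makes 8m + 1 of the form 24x² + y². The second
summand has no exponents ≡ 1 mod 3, and its exponents divisible by 3 are governed by a product of
two theta series with the same consequence. So for m ≢ 2 mod 3, either 3 ∣ b_4(m) or 8m + 1 = 24x² +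
y².

For the primes l in question, -6 is not a square mod l, so l ∣ 24x² + y² forces l² ∣ 24x² + y². The
arguments m in the theorem are chosen so that l divides 8m + 1 exactly once. -/

/-! ### Triangular numbers and terms of theta series -/

/-- The triangular number `k (k + 1) / 2` of an integer `k`. -/
def triangular (k : ℤ) : ℕ := (k * (k + 1) / 2).toNat

theorem two_mul_triangular (k : ℤ) : 2 * (triangular k : ℤ) = k * (k + 1) := by
  have h : 0 ≤ k * (k + 1) := by
    rcases le_or_gt 0 k with h | h
    · positivity
    · nlinarith
  have h2 : (2 : ℤ) ∣ k * (k + 1) := (Int.even_mul_succ_self k).two_dvd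
  rw [triangular, Int.toNat_of_nonneg (by omega)]
  omega

theorem triangular_neg (k : ℤ) : triangular (-k) = triangular (k - 1) := by
  have h₁ := two_mul_triangular (-k)
  have h₂ := two_mul_triangular (k - 1)
  zify
  linarith

theorem triangular_neg_sub_one (k : ℤ) : triangular (-k - 1) = triangular k := by
  have h₁ := two_mul_triangular (-k - 1)
  have h₂ := two_mul_triangular k
  zify
  linarith

theorem triangular_pred_add (k : ℤ) : triangular (k - 1) + triangular k = k.natAbs ^ 2 := by
  have h₁ := two_mul_triangular (k - 1)
  have h₂ := two_mul_triangular k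
  zify
  rw [sq_abs]
  linarith

/-- The general term `a ^ (k (k - 1) / 2) * b ^ (k (k + 1) / 2)` of Ramanujan's theta function. -/
def thetaTerm {R : Type*} [CommRing R] (a b : R) (k : ℤ) : R :=
  a ^ triangular (k - 1) * b ^ triangular k

section term

variable {R : Type*} [CommRing R] (a b : R)

theorem thetaTerm_zero : thetaTerm a b 0 = 1 := by simp [thetaTerm, triangular]

theorem thetaTerm_swap (k : ℤ) : thetaTerm b a k = thetaTerm a b (-k) := by
  rw [thetaTerm, thetaTerm, triangular_neg, triangular_neg_sub_one, mul_comm]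

/-- This shift relation supplies the hypothesis `hz` of `sum_gaussBinom_mul` when the factor `1 + b
* (a * b) ^ r` is adjoined. -/
theorem mul_thetaTerm (r : ℕ) (k : ℤ) (e : ℕ) (h : (r : ℤ) - k = e) :
    b * (a * b) ^ r * thetaTerm a b k = (a * b) ^ e * thetaTerm a b (k + 1) := by
  have h₀ := two_mul_triangular (k - 1)
  have h₁ := two_mul_triangular k
  have h₂ := two_mul_triangular (k + 1)
  have ha : r + triangular (k - 1) = e + triangular k := by zify; linarith
  have hb : 1 + r + triangular k = e + triangular (k + 1) := by zify; linarith
  simp only [thetaTerm, add_sub_cancel_right]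
  calc _ = a ^ (r + triangular (k - 1)) * b ^ (1 + r + triangular k) := by ring
    _ = _ := by rw [ha, hb]; ring

end term

/-! ### Gaussian binomials and the finite Jacobi triple product -/

section field

variable {K : Type*} [Field K]

/-- The finite product `(Q; Q)_n`. -/
def qFactorial {R : Type*} [CommRing R] (Q : R) (n : ℕ) : R :=
  ∏ i ∈ Finset.range n, (1 - Q ^ (i + 1))

/-- The Gaussian binomial coefficient as a quotient of power series. -/
noncomputable def gaussBinom (Q : K⟦X⟧) (M j : ℕ) : K⟦X⟧ :=
  qFactorial Q M * (qFactorial Q j)⁻¹ * (qFactorial Q (M - j))⁻¹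

variable {Q : K⟦X⟧}

theorem qFactorial_succ {R : Type*} [CommRing R] (Q : R) (n : ℕ) :
    qFactorial Q (n + 1) = qFactorial Q n * (1 - Q ^ (n + 1)) := Finset.prod_range_succ _ _

theorem constantCoeff_qFactorial (hQ : X ∣ Q) (n : ℕ) : constantCoeff (qFactorial Q n) = 1 := by
  have := X_dvd_iff.mp hQ
  simp [qFactorial, map_prod, this]

theorem qFactorial_mul_inv (hQ : X ∣ Q) (n : ℕ) : qFactorial Q n * (qFactorial Q n)⁻¹ = 1 :=
  PowerSeries.mul_inv_cancel _ (by simp [constantCoeff_qFactorial hQ])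

theorem qFactorial_ne_zero (hQ : X ∣ Q) (n : ℕ) : qFactorial Q n ≠ 0 := by
  intro h
  have := constantCoeff_qFactorial hQ n
  simp [h] at this

theorem gaussBinom_mul (hQ : X ∣ Q) (M j : ℕ) :
    gaussBinom Q M j * (qFactorial Q j * qFactorial Q (M - j)) = qFactorial Q M := by
  rw [gaussBinom]
  linear_combination (qFactorial Q M * qFactorial Q (M - j) * (qFactorial Q (M - j))⁻¹) *
    qFactorial_mul_inv hQ j + qFactorial Q M * qFactorial_mul_inv hQ (M - j)

theorem gaussBinom_zero (hQ : X ∣ Q) (M : ℕ) : gaussBinom Q M 0 = 1 := by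
  have := qFactorial_mul_inv hQ M
  have := qFactorial_mul_inv hQ 0
  simp_all [gaussBinom, qFactorial]

theorem gaussBinom_symm {M j : ℕ} (h : j ≤ M) : gaussBinom Q M (M - j) = gaussBinom Q M j := by
  rw [gaussBinom, gaussBinom, Nat.sub_sub_self h]
  ring

theorem gaussBinom_self (hQ : X ∣ Q) (M : ℕ) : gaussBinom Q M M = 1 := by
  rw [← gaussBinom_symm le_rfl, Nat.sub_self, gaussBinom_zero hQ]

theorem gaussBinom_succ_succ (hQ : X ∣ Q) (M j : ℕ) (h : j < M) :
    gaussBinom Q (M + 1) (j + 1) = gaussBinom Q M (j + 1) + gaussBinom Q M j * Q ^ (M - j) := by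
  obtain ⟨d, rfl⟩ := Nat.exists_eq_add_of_lt h
  have h₁ := gaussBinom_mul hQ (j + d + 1 + 1) (j + 1)
  have h₂ := gaussBinom_mul hQ (j + d + 1) (j + 1)
  have h₃ := gaussBinom_mul hQ (j + d + 1) j
  rw [show j + d + 1 + 1 - (j + 1) = d + 1 by omega] at h₁
  rw [show j + d + 1 - (j + 1) = d by omega] at h₂
  rw [show j + d + 1 - j = d + 1 by omega] at h₃ ⊢
  simp only [qFactorial_succ] at h₁ h₂ h₃
  have hj := qFactorial_ne_zero hQ (j + 1)
  have hd := qFactorial_ne_zero hQ (d + 1)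
  rw [qFactorial_succ] at hj hd
  refine mul_right_cancel₀ (mul_ne_zero hj hd) ?_
  linear_combination h₁ - (1 - Q ^ (d + 1)) * h₂ - (1 - Q ^ (j + 1)) * Q ^ (d + 1) * h₃

/-- The q-Pascal rule `gaussBinom_succ_succ`, summed against `t`: the inductive step of the
q-binomial theorem. -/
theorem sum_gaussBinom_mul (hQ : X ∣ Q) (M : ℕ) (t : ℕ → K⟦X⟧) (z : K⟦X⟧)
    (hz : ∀ j ≤ M, z * t j = Q ^ (M - j) * t (j + 1)) :
    (∑ j ∈ Finset.range (M + 1), gaussBinom Q M j * t j) * (1 + z) =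
      ∑ j ∈ Finset.range (M + 2), gaussBinom Q (M + 1) j * t j := by
  have h : (∑ j ∈ Finset.range (M + 1), gaussBinom Q M j * t j) * z =
      ∑ j ∈ Finset.range (M + 1), gaussBinom Q M j * Q ^ (M - j) * t (j + 1) := by
    rw [Finset.sum_mul]
    refine Finset.sum_congr rfl fun j hj => ?_
    linear_combination gaussBinom Q M j * hz j (by simpa [Nat.lt_succ_iff] using hj)
  rw [mul_add, mul_one, h, Finset.sum_range_succ', Finset.sum_range_succ _ M,
    Finset.sum_range_succ', Finset.sum_range_succ _ M]
  simp only [gaussBinom_zero hQ, gaussBinom_self hQ, Nat.sub_self, pow_zero]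
  have h' : ∑ j ∈ Finset.range M, gaussBinom Q (M + 1) (j + 1) * t (j + 1) =
      ∑ j ∈ Finset.range M, gaussBinom Q M (j + 1) * t (j + 1) +
      ∑ j ∈ Finset.range M, gaussBinom Q M j * Q ^ (M - j) * t (j + 1) := by
    rw [← Finset.sum_add_distrib]
    refine Finset.sum_congr rfl fun j hj => ?_
    rw [gaussBinom_succ_succ hQ M j (Finset.mem_range.mp hj)]
    ring
  rw [h']
  ring

theorem prod_mul_prod_eq_of_start {a b : K⟦X⟧} (hQ : X ∣ a * b) (p : ℕ) (c : K⟦X⟧)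
    (h₀ : c = ∑ j ∈ Finset.range (p + 1), gaussBinom (a * b) p j * thetaTerm a b (j - p)) (r : ℕ) :
    c * ∏ i ∈ Finset.range r, (1 + b * (a * b) ^ i) =
      ∑ j ∈ Finset.range (p + r + 1), gaussBinom (a * b) (p + r) j * thetaTerm a b (j - p) := by
  induction r with
  | zero => simpa using h₀
  | succ r ih =>
    rw [Finset.prod_range_succ, ← mul_assoc, ih,
      sum_gaussBinom_mul hQ (p + r) (fun j => thetaTerm a b (j - p))]
    · rfl
    · intro j hj
      rw [mul_thetaTerm a b r _ (p + r - j) (by push_cast [hj]; ring)]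
      congr 2
      push_cast
      ring

theorem prod_one_add_eq {a b : K⟦X⟧} (hQ : X ∣ a * b) (p : ℕ) :
    ∏ i ∈ Finset.range p, (1 + a * (a * b) ^ i) =
      ∑ j ∈ Finset.range (p + 1), gaussBinom (a * b) p j * thetaTerm a b (j - p) := by
  have hQ' : X ∣ b * a := mul_comm a b ▸ hQ
  -- With `a` and `b` exchanged and `p = 0`, the starting sum is trivial; reversing the order of
  -- summation then exchanges them back.
  have h := prod_mul_prod_eq_of_start hQ' 0 1 (by simp [gaussBinom_zero hQ', thetaTerm_zero]) p
  rw [one_mul, zero_add] at h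
  rw [mul_comm a b, h, ← Finset.sum_range_reflect]
  refine Finset.sum_congr rfl fun j hj => ?_
  have hj' : j ≤ p := by simpa [Nat.lt_succ_iff] using hj
  rw [Nat.add_sub_cancel, gaussBinom_symm hj', thetaTerm_swap]
  congr 2
  push_cast [hj']
  ring

theorem prod_mul_prod_eq_sum_gaussBinom {a b : K⟦X⟧} (hQ : X ∣ a * b) (p r : ℕ) :
    (∏ i ∈ Finset.range p, (1 + a * (a * b) ^ i)) * ∏ i ∈ Finset.range r, (1 + b * (a * b) ^ i) =
      ∑ j ∈ Finset.range (p + r + 1), gaussBinom (a * b) (p + r) j * thetaTerm a b (j - p) :=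
  prod_mul_prod_eq_of_start hQ p _ (prod_one_add_eq hQ p) r

theorem prod_mul_prod_eq_sum_Icc {a b : K⟦X⟧} (hQ : X ∣ a * b) (N : ℕ) :
    (∏ i ∈ Finset.range N, (1 + a * (a * b) ^ i)) * ∏ i ∈ Finset.range N, (1 + b * (a * b) ^ i) =
      ∑ k ∈ Finset.Icc (-N : ℤ) N, gaussBinom (a * b) (N + N) (N + k).toNat * thetaTerm a b k := by
  rw [prod_mul_prod_eq_sum_gaussBinom hQ]
  refine Finset.sum_bij (fun j _ => (j : ℤ) - N) ?_ ?_ ?_ ?_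
  · intro j hj
    simp only [Finset.mem_range, Finset.mem_Icc] at *
    omega
  · intro i _ j _ h
    omega
  · intro k hk
    simp only [Finset.mem_Icc] at hk
    exact ⟨(N + k).toNat, by simp; omega, by omega⟩
  · intro j _
    simp

theorem dvd_qFactorial_sub (Q : K⟦X⟧) {m n : ℕ} (h : m ≤ n) :
    Q ^ (m + 1) ∣ qFactorial Q n - qFactorial Q m := by
  induction n, h using Nat.le_induction with
  | base => simp
  | succ n hn ih =>
    have : qFactorial Q (n + 1) - qFactorial Q m =
        (qFactorial Q n - qFactorial Q m) - qFactorial Q n * Q ^ (n + 1) := by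
      rw [qFactorial_succ]; ring
    rw [this]
    exact dvd_sub ih ((pow_dvd_pow _ (by omega)).mul_left _)

/-- All the q-factorials involved agree with `qFactorial Q m` modulo `Q ^ (m + 1)`, so after
clearing the unit denominators both sides become its square. -/
theorem dvd_gaussBinom_mul_sub_one (hQ : X ∣ Q) {m d e n : ℕ} (hd : m ≤ d) (he : m ≤ e)
    (hn : m ≤ n) : Q ^ (m + 1) ∣ gaussBinom Q (d + e) d * qFactorial Q n - 1 := by
  have h := gaussBinom_mul hQ (d + e) d
  rw [Nat.add_sub_cancel_left] at h
  have hu : IsUnit (qFactorial Q d * qFactorial Q e) := by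
    rw [isUnit_iff_constantCoeff]
    simp [constantCoeff_qFactorial hQ]
  refine (hu.dvd_mul_right).mp ?_
  have e1 : (gaussBinom Q (d + e) d * qFactorial Q n - 1) * (qFactorial Q d * qFactorial Q e) =
      (qFactorial Q (d + e) - qFactorial Q m) * qFactorial Q n
      + qFactorial Q m * (qFactorial Q n - qFactorial Q m)
      - (qFactorial Q d - qFactorial Q m) * qFactorial Q e
      - qFactorial Q m * (qFactorial Q e - qFactorial Q m) := by
    linear_combination qFactorial Q n * h
  rw [e1]
  exact dvd_sub (dvd_sub (dvd_add ((dvd_qFactorial_sub Q (by omega)).mul_right _)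
    ((dvd_qFactorial_sub Q hn).mul_left _)) ((dvd_qFactorial_sub Q hd).mul_right _))
    ((dvd_qFactorial_sub Q he).mul_left _)

theorem X_pow_dvd_thetaTerm {R : Type*} [CommRing R] {a b : R⟦X⟧} (ha : X ∣ a) (hb : X ∣ b)
    (k : ℤ) : X ^ k.natAbs ∣ thetaTerm a b k := by
  refine dvd_trans (pow_dvd_pow X (n := triangular (k - 1) + triangular k) ?_) ?_
  · rw [triangular_pred_add]
    exact Nat.le_self_pow two_ne_zero _
  · rw [pow_add]
    exact mul_dvd_mul (pow_dvd_pow_of_dvd ha _) (pow_dvd_pow_of_dvd hb _)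

/-- Ramanujan's theta function `∑ a ^ (k (k - 1) / 2) * b ^ (k (k + 1) / 2)`, for power series
`a` and `b` without constant term. -/
noncomputable def thetaSeries {R : Type*} [CommRing R] (a b : R⟦X⟧) : R⟦X⟧ :=
  mk fun n => coeff n (∑ k ∈ Finset.Icc (-n : ℤ) n, thetaTerm a b k)

theorem coeff_thetaSeries {R : Type*} [CommRing R] {a b : R⟦X⟧} (ha : X ∣ a) (hb : X ∣ b)
    {n N : ℕ} (h : n ≤ N) :
    coeff n (thetaSeries a b) = coeff n (∑ k ∈ Finset.Icc (-N : ℤ) N, thetaTerm a b k) := by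
  rw [thetaSeries, coeff_mk, map_sum, map_sum]
  refine Finset.sum_subset (Finset.Icc_subset_Icc (by omega) (by omega)) fun k _ hk => ?_
  refine X_pow_dvd_iff.mp (X_pow_dvd_thetaTerm ha hb k) n ?_
  simp only [Finset.mem_Icc] at hk
  omega

theorem X_pow_dvd_thetaSeries_sub {R : Type*} [CommRing R] {a b : R⟦X⟧} (ha : X ∣ a) (hb : X ∣ b)
    (N : ℕ) : X ^ (N + 1) ∣ thetaSeries a b - ∑ k ∈ Finset.Icc (-N : ℤ) N, thetaTerm a b k := by
  rw [X_pow_dvd_iff]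
  intro n hn
  rw [map_sub, coeff_thetaSeries ha hb (Nat.lt_succ_iff.mp hn), sub_self]

/-- A truncated form of the Jacobi triple product identity. -/
theorem X_pow_dvd_prod_sub_thetaSeries {a b : K⟦X⟧} (ha : X ∣ a) (hb : X ∣ b) (N : ℕ) :
    X ^ (N + 1) ∣ ∏ i ∈ Finset.range N,
      ((1 + a * (a * b) ^ i) * (1 + b * (a * b) ^ i) * (1 - (a * b) ^ (i + 1))) -
        thetaSeries a b := by
  have hQ : X ∣ a * b := ha.mul_right _
  refine (dvd_sub_comm.mp ?_)
  have h : thetaSeries a b - ∏ i ∈ Finset.range N,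
      ((1 + a * (a * b) ^ i) * (1 + b * (a * b) ^ i) * (1 - (a * b) ^ (i + 1))) =
      (thetaSeries a b - ∑ k ∈ Finset.Icc (-N : ℤ) N, thetaTerm a b k) -
      ∑ k ∈ Finset.Icc (-N : ℤ) N, (gaussBinom (a * b) (N + N) (N + k).toNat *
        qFactorial (a * b) N - 1) * thetaTerm a b k := by
    rw [Finset.prod_mul_distrib, Finset.prod_mul_distrib, prod_mul_prod_eq_sum_Icc hQ,
      Finset.sum_mul, ← qFactorial, sub_sub, ← Finset.sum_add_distrib]
    congr 1
    refine Finset.sum_congr rfl fun k _ => ?_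
    ring
  rw [h]
  refine dvd_sub (X_pow_dvd_thetaSeries_sub ha hb N) (Finset.dvd_sum fun k hk => ?_)
  rw [Finset.mem_Icc] at hk
  have h₁ : (a * b) ^ (N - k.natAbs + 1) ∣ gaussBinom (a * b) (N + N) (N + k).toNat *
      qFactorial (a * b) N - 1 := by
    rw [show N + N = (N + k).toNat + (N - k).toNat by omega]
    exact dvd_gaussBinom_mul_sub_one hQ (by omega) (by omega) (by omega)
  -- The Gaussian binomial is less accurate for large |k|, but the theta term makes up exactly for
  -- the lost |k| powers of `X`.
  rw [show N + 1 = (N - k.natAbs + 1) + k.natAbs by omega, pow_add]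
  exact mul_dvd_mul ((pow_dvd_pow_of_dvd hQ _).trans h₁) (X_pow_dvd_thetaTerm ha hb k)

end field

/-! ### Infinite products as limits -/

section limits

variable {R : Type*} [CommRing R] [TopologicalSpace R]

theorem tendsto_of_X_pow_dvd_sub {s : ℕ → R⟦X⟧} {F : R⟦X⟧} (h : ∀ N, X ^ (N + 1) ∣ s N - F) :
    Tendsto s atTop (𝓝 F) := by
  rw [tendsto_iff_coeff_tendsto]
  intro d
  refine tendsto_const_nhds.congr' ?_
  filter_upwards [eventually_ge_atTop d] with N hN
  have := X_pow_dvd_iff.mp (h N) d (by omega)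
  rw [map_sub, sub_eq_zero] at this
  exact this.symm

theorem tendsto_prod_one_add {f : ℕ → R⟦X⟧} (h : ∀ i, X ^ (i + 1) ∣ f i) :
    Tendsto (fun N => ∏ i ∈ Finset.range N, (1 + f i)) atTop (𝓝 (∏' i, (1 + f i))) := by
  refine (multipliable_one_add_of_tendsto_order_atTop_nhds_top R ?_).hasProd.tendsto_prod_nat
  refine ENat.tendsto_nhds_top_iff_natCast_lt.mpr fun n => eventually_atTop.mpr ⟨n, fun m hm => ?_⟩
  refine lt_of_lt_of_le (b := ((m + 1 : ℕ) : ℕ∞)) (by exact_mod_cast Nat.lt_succ_of_le hm) ?_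
  exact nat_le_order _ _ fun i hi => X_pow_dvd_iff.mp (h m) i hi

theorem prod_range_two_mul {M : Type*} [CommMonoid M] (p : ℕ → M) (N : ℕ) :
    ∏ i ∈ Finset.range (2 * N), p i = ∏ i ∈ Finset.range N, (p (2 * i) * p (2 * i + 1)) := by
  induction N with
  | zero => simp
  | succ N ih =>
    rw [mul_add, Finset.prod_range_succ, Finset.prod_range_succ, ih, Finset.prod_range_succ,
      mul_assoc]

theorem prod_range_three_mul {M : Type*} [CommMonoid M] (p : ℕ → M) (N : ℕ) :
    ∏ i ∈ Finset.range (3 * N), p i =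
      ∏ i ∈ Finset.range N, (p (3 * i) * p (3 * i + 1) * p (3 * i + 2)) := by
  induction N with
  | zero => simp
  | succ N ih =>
    rw [mul_add, Finset.prod_range_succ, Finset.prod_range_succ, Finset.prod_range_succ, ih,
      Finset.prod_range_succ, mul_assoc, mul_assoc, mul_assoc]

theorem tendsto_const_mul_atTop_nat {d : ℕ} (hd : 0 < d) : Tendsto (fun N : ℕ => d * N) atTop atTop :=
  tendsto_id.const_mul_atTop' hd

variable (R)

/-- The infinite product `∏ (1 - q ^ (d * i))` over `i ≥ 1`. -/
noncomputable def eulerProd (d : ℕ) : R⟦X⟧ := ∏' i, (1 + -X ^ (d * (i + 1)))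

/-- The infinite product `∏ (1 + q ^ (d * i))` over `i ≥ 1`. -/
noncomputable def distinctProd (d : ℕ) : R⟦X⟧ := ∏' i, (1 + X ^ (d * (i + 1)))

/-- The infinite product `∏ (1 - q ^ (d * i))` over odd `i ≥ 1`. -/
noncomputable def oddEulerProd (d : ℕ) : R⟦X⟧ := ∏' i, (1 + -X ^ (d * (2 * i + 1)))

/-- The infinite product `∏ (1 + q ^ i)` over odd `i ≥ 1`. -/
noncomputable def oddDistinctProd : R⟦X⟧ := ∏' i, (1 + X ^ (2 * i + 1))

theorem tendsto_eulerProd {d : ℕ} (hd : 0 < d) :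
    Tendsto (fun N => ∏ i ∈ Finset.range N, (1 - X ^ (d * (i + 1)))) atTop (𝓝 (eulerProd R d)) := by
  simp only [sub_eq_add_neg]
  exact tendsto_prod_one_add fun i => (pow_dvd_pow _ (Nat.le_mul_of_pos_left _ hd)).neg_right

theorem tendsto_distinctProd {d : ℕ} (hd : 0 < d) :
    Tendsto (fun N => ∏ i ∈ Finset.range N, (1 + X ^ (d * (i + 1)))) atTop
      (𝓝 (distinctProd R d)) :=
  tendsto_prod_one_add fun _ => (pow_dvd_pow _ (Nat.le_mul_of_pos_left _ hd))

theorem tendsto_oddEulerProd {d : ℕ} (hd : 0 < d) :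
    Tendsto (fun N => ∏ i ∈ Finset.range N, (1 - X ^ (d * (2 * i + 1)))) atTop
      (𝓝 (oddEulerProd R d)) := by
  simp only [sub_eq_add_neg]
  exact tendsto_prod_one_add fun i => (pow_dvd_pow _ (by nlinarith)).neg_right

theorem tendsto_oddDistinctProd :
    Tendsto (fun N => ∏ i ∈ Finset.range N, (1 + X ^ (2 * i + 1))) atTop
      (𝓝 (oddDistinctProd R)) :=
  tendsto_prod_one_add fun _ => (pow_dvd_pow _ (by omega))

variable [T2Space R] [IsTopologicalRing R]

omit [IsTopologicalRing R] in
theorem constantCoeff_of_tendsto {p : ℕ → R⟦X⟧} {F : R⟦X⟧}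
    (h : Tendsto (fun N => ∏ i ∈ Finset.range N, p i) atTop (𝓝 F))
    (hp : ∀ i, constantCoeff (p i) = 1) : constantCoeff F = 1 := by
  refine tendsto_nhds_unique (((continuous_constantCoeff R).tendsto F).comp h) ?_
  simp [Function.comp_def, map_prod, hp]

theorem eulerProd_mul_distinctProd {d : ℕ} (hd : 0 < d) :
    eulerProd R d * distinctProd R d = eulerProd R (2 * d) := by
  refine tendsto_nhds_unique ((tendsto_eulerProd R hd).mul (tendsto_distinctProd R hd)) ?_
  refine (tendsto_eulerProd R (d := 2 * d) (by omega)).congr fun N => ?_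
  rw [← Finset.prod_mul_distrib]
  exact Finset.prod_congr rfl fun i _ => by ring

theorem oddEulerProd_mul_eulerProd {d : ℕ} (hd : 0 < d) :
    oddEulerProd R d * eulerProd R (2 * d) = eulerProd R d := by
  refine tendsto_nhds_unique
    ((tendsto_oddEulerProd R hd).mul (tendsto_eulerProd R (d := 2 * d) (by omega))) ?_
  refine ((tendsto_eulerProd R hd).comp (tendsto_const_mul_atTop_nat two_pos)).congr fun N => ?_
  rw [← Finset.prod_mul_distrib, Function.comp_apply, prod_range_two_mul]
  exact Finset.prod_congr rfl fun i _ => by ring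

theorem oddDistinctProd_mul_distinctProd :
    oddDistinctProd R * distinctProd R 2 = distinctProd R 1 := by
  refine tendsto_nhds_unique
    ((tendsto_oddDistinctProd R).mul (tendsto_distinctProd R two_pos)) ?_
  refine ((tendsto_distinctProd R one_pos).comp
    (tendsto_const_mul_atTop_nat two_pos)).congr fun N => ?_
  rw [← Finset.prod_mul_distrib, Function.comp_apply, prod_range_two_mul]
  exact Finset.prod_congr rfl fun i _ => by ring

omit [IsTopologicalRing R] in
theorem eulerProd_ne_zero [Nontrivial R] {d : ℕ} (hd : 0 < d) : eulerProd R d ≠ 0 := by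
  intro h
  have := constantCoeff_of_tendsto R (tendsto_eulerProd R hd) fun _ => by
    simp [hd.ne']
  simp [h] at this

omit [IsTopologicalRing R] in
theorem distinctProd_ne_zero [Nontrivial R] {d : ℕ} (hd : 0 < d) : distinctProd R d ≠ 0 := by
  intro h
  have := constantCoeff_of_tendsto R (tendsto_distinctProd R hd) fun _ => by
    simp [hd.ne']
  simp [h] at this

theorem oddEulerProd_mul_distinctProd [IsDomain R] {d : ℕ} (hd : 0 < d) :
    oddEulerProd R d * distinctProd R d = 1 := by
  refine mul_right_cancel₀ (eulerProd_ne_zero R hd) ?_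
  linear_combination oddEulerProd R d * eulerProd_mul_distinctProd R hd +
    oddEulerProd_mul_eulerProd R hd

end limits

/-! ### Product formulas for the theta series -/

section theta

variable (K : Type*) [Field K] [TopologicalSpace K] [T2Space K] [IsTopologicalRing K]

omit [T2Space K] [IsTopologicalRing K] in
/-- The Jacobi triple product identity. -/
theorem tendsto_thetaSeries {a b : K⟦X⟧} (ha : X ∣ a) (hb : X ∣ b) :
    Tendsto (fun N => ∏ i ∈ Finset.range N,
      ((1 + a * (a * b) ^ i) * (1 + b * (a * b) ^ i) * (1 - (a * b) ^ (i + 1)))) atTop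
      (𝓝 (thetaSeries a b)) :=
  tendsto_of_X_pow_dvd_sub (X_pow_dvd_prod_sub_thetaSeries ha hb)

theorem thetaSeries_neg_X_pow {d : ℕ} (hd : 0 < d) :
    thetaSeries (-X ^ d : K⟦X⟧) (-X ^ d) * distinctProd K d = eulerProd K d := by
  have hX : (X : K⟦X⟧) ∣ -X ^ d := (dvd_pow_self _ hd.ne').neg_right
  have h : thetaSeries (-X ^ d : K⟦X⟧) (-X ^ d) = oddEulerProd K d ^ 2 * eulerProd K (2 * d) := by
    refine tendsto_nhds_unique (tendsto_thetaSeries K hX hX) ?_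
    refine (((tendsto_oddEulerProd K hd).pow 2).mul
      (tendsto_eulerProd K (d := 2 * d) (by omega))).congr fun N => ?_
    rw [← Finset.prod_pow, ← Finset.prod_mul_distrib]
    exact Finset.prod_congr rfl fun i _ => by ring
  have h₁ := eulerProd_mul_distinctProd K hd
  have h₂ := oddEulerProd_mul_distinctProd K hd
  rw [h, ← h₁]
  linear_combination (oddEulerProd K d * distinctProd K d + 1) * eulerProd K d * h₂

theorem thetaSeries_X :
    thetaSeries (X : K⟦X⟧) X * distinctProd K 2 ^ 2 = eulerProd K 1 * distinctProd K 1 ^ 3 := by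
  have h : thetaSeries (X : K⟦X⟧) X = oddDistinctProd K ^ 2 * eulerProd K 2 := by
    refine tendsto_nhds_unique (tendsto_thetaSeries K dvd_rfl dvd_rfl) ?_
    refine (((tendsto_oddDistinctProd K).pow 2).mul
      (tendsto_eulerProd K two_pos)).congr fun N => ?_
    rw [← Finset.prod_pow, ← Finset.prod_mul_distrib]
    exact Finset.prod_congr rfl fun i _ => by ring
  have h₁ := eulerProd_mul_distinctProd K one_pos
  rw [mul_one] at h₁
  have h₂ := oddDistinctProd_mul_distinctProd K
  rw [h, ← h₁, ← h₂]
  ring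

theorem thetaSeries_neg_X_neg_X_cube :
    thetaSeries (-X : K⟦X⟧) (-X ^ 3) = eulerProd K 1 * distinctProd K 2 := by
  have h : thetaSeries (-X : K⟦X⟧) (-X ^ 3) = oddEulerProd K 1 * eulerProd K 4 := by
    refine tendsto_nhds_unique (tendsto_thetaSeries K dvd_rfl.neg_right
      (dvd_pow_self _ three_ne_zero).neg_right) ?_
    refine (((tendsto_oddEulerProd K one_pos).comp (tendsto_const_mul_atTop_nat two_pos)).mul
      (tendsto_eulerProd K four_pos)).congr fun N => ?_
    rw [Function.comp_apply, prod_range_two_mul, ← Finset.prod_mul_distrib]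
    exact Finset.prod_congr rfl fun i _ => by ring
  have h₁ := eulerProd_mul_distinctProd K one_pos
  rw [mul_one] at h₁
  have h₂ := eulerProd_mul_distinctProd K two_pos
  have h₃ := oddEulerProd_mul_distinctProd K one_pos
  norm_num at h₂
  rw [h, ← h₂, ← h₁]
  linear_combination eulerProd K 1 * distinctProd K 2 * h₃

/-- With y = -q the triple product is ∏ (1 + y^(3i+1)) (1 + y^(3i+2)) (1 - y^(3i+3)). In
characteristic 3, cubing D = ∏ (1 + y^i) supplies the missing factors 1 + y^(3i+3), and the
remaining ones form the cube of E = ∏ (1 - y^i). -/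
theorem thetaSeries_neg_X_X_sq [CharP K 3] :
    thetaSeries (-X : K⟦X⟧) (X ^ 2) * distinctProd K 2 ^ 5 =
      eulerProd K 1 ^ 3 * distinctProd K 1 ^ 8 := by
  have hdvd : ∀ i, (X : K⟦X⟧) ^ (i + 1) ∣ (-X) ^ (i + 1) := fun i =>
    pow_dvd_pow_of_dvd dvd_rfl.neg_right _
  have hD := tendsto_prod_one_add hdvd
  have hE := tendsto_prod_one_add fun i => (hdvd i).neg_right
  set D := ∏' i, (1 + (-X : K⟦X⟧) ^ (i + 1))
  set E := ∏' i, (1 + -(-X : K⟦X⟧) ^ (i + 1))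
  have hc : ∀ z : K⟦X⟧, 1 + z ^ 3 = (1 + z) ^ 3 := by
    intro z
    have h3 : (3 : K⟦X⟧) = 0 := by
      have h := CharP.cast_eq_zero K 3
      rw [← map_ofNat (C (R := K)) 3, ← Nat.cast_ofNat, h, map_zero]
    linear_combination (-z - z ^ 2) * h3
  have hP : thetaSeries (-X : K⟦X⟧) (X ^ 2) * D ^ 3 = D * E ^ 3 := by
    refine tendsto_nhds_unique ((tendsto_thetaSeries K dvd_rfl.neg_right
      (dvd_pow_self _ two_ne_zero)).mul (hD.pow 3)) ?_
    refine ((hD.comp (tendsto_const_mul_atTop_nat three_pos)).mul (hE.pow 3)).congr fun N => ?_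
    simp only [Function.comp_apply]
    rw [prod_range_three_mul, ← Finset.prod_pow, ← Finset.prod_pow, ← Finset.prod_mul_distrib,
      ← Finset.prod_mul_distrib]
    refine Finset.prod_congr rfl fun i _ => ?_
    rw [show -X * X ^ 2 = (-X : K⟦X⟧) ^ 3 by ring, show (X : K⟦X⟧) ^ 2 = (-X) ^ 2 by ring]
    generalize (-X : K⟦X⟧) = y
    rw [← hc (y ^ (i + 1)), ← hc (-y ^ (i + 1))]
    ring
  have hD' : D = oddEulerProd K 1 * distinctProd K 2 := by
    refine tendsto_nhds_unique (hD.comp (tendsto_const_mul_atTop_nat two_pos)) ?_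
    refine ((tendsto_oddEulerProd K one_pos).mul (tendsto_distinctProd K two_pos)).congr fun N => ?_
    rw [← Finset.prod_mul_distrib, Function.comp_apply, prod_range_two_mul]
    refine Finset.prod_congr rfl fun i _ => ?_
    rw [(by simp : Odd (2 * i + 1)).neg_pow, show 2 * i + 1 + 1 = 2 * (i + 1) by ring,
      (by simp : Even (2 * (i + 1))).neg_pow]
    ring
  have hE' : E = oddDistinctProd K * eulerProd K 2 := by
    refine tendsto_nhds_unique (hE.comp (tendsto_const_mul_atTop_nat two_pos)) ?_
    refine ((tendsto_oddDistinctProd K).mul (tendsto_eulerProd K two_pos)).congr fun N => ?_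
    rw [← Finset.prod_mul_distrib, Function.comp_apply, prod_range_two_mul]
    refine Finset.prod_congr rfl fun i _ => ?_
    rw [(by simp : Odd (2 * i + 1)).neg_pow, show 2 * i + 1 + 1 = 2 * (i + 1) by ring,
      (by simp : Even (2 * (i + 1))).neg_pow]
    ring
  have h₁ := eulerProd_mul_distinctProd K one_pos
  rw [mul_one] at h₁
  have h₂ := oddDistinctProd_mul_distinctProd K
  have h₃ := oddEulerProd_mul_distinctProd K one_pos
  have hDG : D * distinctProd K 1 = distinctProd K 2 := by
    rw [hD']; linear_combination distinctProd K 2 * h₃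
  have hEG : E * distinctProd K 2 = eulerProd K 1 * distinctProd K 1 ^ 2 := by
    rw [hE', ← h₁]; linear_combination eulerProd K 1 * distinctProd K 1 * h₂
  have hD0 : D ≠ 0 := by
    rintro h
    rw [h, zero_mul] at hDG
    exact distinctProd_ne_zero K two_pos hDG.symm
  have hP' : thetaSeries (-X : K⟦X⟧) (X ^ 2) * D ^ 2 = E ^ 3 :=
    mul_left_cancel₀ hD0 (by linear_combination hP)
  calc _ = thetaSeries (-X : K⟦X⟧) (X ^ 2) * (D * distinctProd K 1) ^ 2 * distinctProd K 2 ^ 3 := by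
        rw [hDG]; ring
    _ = (E * distinctProd K 2) ^ 3 * distinctProd K 1 ^ 2 := by
        linear_combination distinctProd K 1 ^ 2 * distinctProd K 2 ^ 3 * hP'
    _ = _ := by rw [hEG]; ring

/-- The generating function of partitions with no part divisible by four. -/
theorem mk_card_restricted_four :
    (PowerSeries.mk fun n => ((Nat.Partition.restricted n (fun i => ¬ 4 ∣ i)).card : K)) =
      distinctProd K 1 * distinctProd K 2 := by
  rw [Nat.Partition.powerSeriesMk_card_restricted_eq_powerSeriesMk_card_countRestricted K four_pos]
  refine tendsto_nhds_unique
    (Nat.Partition.hasProd_powerSeriesMk_card_countRestricted K four_pos).tendsto_prod_nat ?_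
  refine ((tendsto_distinctProd K one_pos).mul (tendsto_distinctProd K two_pos)).congr fun N => ?_
  rw [← Finset.prod_mul_distrib]
  refine Finset.prod_congr rfl fun i _ => ?_
  change _ = ∑ j ∈ Finset.range 4, (X : K⟦X⟧) ^ ((i + 1) * j)
  simp only [Finset.sum_range_succ, Finset.sum_range_zero]
  ring

end theta

/-! ### Exponents occurring in the theta series -/

section support

variable {R : Type*} [CommRing R]

theorem exists_of_coeff_thetaSeries_ne_zero {a b : R⟦X⟧} {u v : R} {α β n : ℕ}
    (ha : a = C u * X ^ α) (hb : b = C v * X ^ β) (h : coeff n (thetaSeries a b) ≠ 0) :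
    ∃ k : ℤ, n = α * triangular (k - 1) + β * triangular k := by
  rw [thetaSeries, coeff_mk, map_sum] at h
  obtain ⟨k, -, hk⟩ := Finset.exists_ne_zero_of_sum_ne_zero h
  refine ⟨k, ?_⟩
  rw [thetaTerm, ha, hb, mul_pow, mul_pow, ← pow_mul, ← pow_mul, mul_mul_mul_comm, ← pow_add,
    ← map_pow, ← map_pow, ← map_mul, coeff_C_mul, coeff_X_pow] at hk
  by_contra hn
  simp [hn] at hk

theorem thetaTerm_self (z : R) (k : ℤ) : thetaTerm z z k = z ^ k.natAbs ^ 2 := by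
  rw [thetaTerm, ← pow_add, triangular_pred_add]

theorem coeff_thetaTerm_neg_X_sq (n : ℕ) (k : ℤ) :
    coeff n (thetaTerm (-X ^ 2 : R⟦X⟧) (-X ^ 2) k) =
      if n = 2 * k.natAbs ^ 2 then (-1) ^ k.natAbs ^ 2 else 0 := by
  rw [thetaTerm_self, neg_pow, ← pow_mul, ← map_one (C (R := R)), ← map_neg, ← map_pow,
    coeff_C_mul, coeff_X_pow]
  split_ifs <;> simp

theorem coeff_nine_mul_thetaSeries (j : ℕ) :
    coeff (9 * j) (thetaSeries (-X ^ 2 : R⟦X⟧) (-X ^ 2)) =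
      coeff j (thetaSeries (-X ^ 2 : R⟦X⟧) (-X ^ 2)) := by
  have hX : (X : R⟦X⟧) ∣ -X ^ 2 := (dvd_pow_self _ two_ne_zero).neg_right
  -- The truncations 27j and 9j are matched so that k ↦ 3k carries one range into the other.
  rw [coeff_thetaSeries hX hX (show 9 * j ≤ 27 * j by omega),
    coeff_thetaSeries hX hX (show j ≤ 9 * j by omega), map_sum, map_sum]
  symm
  refine Finset.sum_of_injOn (fun k => 3 * k) (fun _ _ _ _ h => by simpa using h) ?_ ?_ ?_
  · intro k hk
    simp only [Finset.coe_Icc, Set.mem_Icc] at *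
    omega
  · intro k hk hk'
    rw [coeff_thetaTerm_neg_X_sq, if_neg]
    intro h
    have h3 : 3 ∣ k.natAbs := by
      refine Nat.prime_three.dvd_of_dvd_pow (n := 2) ?_
      omega
    obtain ⟨c, rfl⟩ := Int.natCast_dvd.mpr h3
    refine hk' ⟨c, ?_, rfl⟩
    simp only [Finset.coe_Icc, Set.mem_Icc, Finset.mem_Icc] at *
    omega
  · intro k _
    simp only [coeff_thetaTerm_neg_X_sq, Int.natAbs_mul, mul_pow]
    have : (9 * j = 2 * (Int.natAbs 3 ^ 2 * k.natAbs ^ 2)) ↔ j = 2 * k.natAbs ^ 2 := by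
      norm_num
      omega
    simp only [this, pow_mul]
    norm_num

end support

/-! ### Representations by x² + 3y² -/

section representations

/-- Multiplication by a primitive cube root of unity, in the coordinates `x + y √-3`. -/
def rotateThird (p : ℤ × ℤ) : ℤ × ℤ := (-2 * p.2 - (p.1 - p.2) / 2, (p.1 - p.2) / 2)

theorem sq_add_three_mul_sq_rotateThird {p : ℤ × ℤ} (h : 2 ∣ p.1 - p.2) :
    (rotateThird p).1 ^ 2 + 3 * (rotateThird p).2 ^ 2 = p.1 ^ 2 + 3 * p.2 ^ 2 := by
  obtain ⟨x, y⟩ := p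
  obtain ⟨m, hm⟩ := h
  obtain rfl : x = y + 2 * m := by simp only at hm; omega
  simp only [rotateThird, add_sub_cancel_left, ne_eq, OfNat.ofNat_ne_zero, not_false_eq_true,
    Int.mul_ediv_cancel_left]
  ring

theorem two_dvd_sub_of_even {x y : ℤ} {n : ℕ} (hn : Even n) (h : x ^ 2 + 3 * y ^ 2 = n) :
    2 ∣ x - y := by
  have h' : Even (x ^ 2 + 3 * y ^ 2) := by rw [h]; exact_mod_cast hn
  rw [← even_iff_two_dvd]
  simpa [Int.even_add, Int.even_sub, Int.even_mul, Int.even_pow, show ¬ Even (3 : ℤ) by decide]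
    using h'

/-- Evenness of `n` forces x ≡ y mod 2, so multiplication by the cube root of unity preserves
integrality. It has order dividing 3 and fixes only the origin, which `h0` excludes. -/
theorem three_dvd_card_sq_add_three_mul_sq {n : ℕ} (hn : Even n) (h0 : 0 < n)
    (S : Finset (ℤ × ℤ)) (hS : ∀ p, p ∈ S ↔ p.1 ^ 2 + 3 * p.2 ^ 2 = n) : 3 ∣ S.card := by
  have hpar : ∀ p ∈ S, 2 ∣ p.1 - p.2 := fun p hp => two_dvd_sub_of_even hn ((hS p).mp hp)
  have hmem : ∀ p ∈ S, rotateThird p ∈ S := fun p hp => by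
    rw [hS, sq_add_three_mul_sq_rotateThird (hpar p hp)]
    exact (hS p).mp hp
  let f : Function.End S := fun p => ⟨rotateThird p, hmem p p.2⟩
  have hf : f ^ 3 ^ 1 = 1 := by
    funext p
    refine Subtype.ext ?_
    change rotateThird (rotateThird (rotateThird p.1)) = p.1
    have h := hpar p.1 p.2
    simp only [rotateThird]
    ext <;> simp only <;> omega
  have hcard := Equiv.Perm.card_fixedPoints_modEq hf
  have hfix : IsEmpty (Function.fixedPoints f) := by
    refine ⟨fun ⟨p, hp⟩ => ?_⟩
    have hp' : rotateThird p.1 = p.1 := congrArg Subtype.val hp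
    have h := hpar p.1 p.2
    have hn := (hS p.1).mp p.2
    have h1 := congrArg Prod.fst hp'
    have h2 := congrArg Prod.snd hp'
    simp only [rotateThird] at h1 h2
    have hy : p.1.2 = 0 := by omega
    have hx : p.1.1 = 0 := by omega
    rw [hx, hy] at hn
    simp at hn
    omega
  rw [Fintype.card_eq_zero (α := Function.fixedPoints f), Fintype.card_coe] at hcard
  exact (Nat.modEq_zero_iff_dvd).mp hcard

end representations

/-! ### Cubes and fourth powers modulo 3 -/

section modThree

theorem charP_powerSeries_zmod_three : CharP (ZMod 3)⟦X⟧ 3 :=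
  charP_of_injective_ringHom C_injective 3

/-- Frobenius is the identity on `ZMod 3`, so cubing only replaces q by q³. -/
theorem cube_eq_expand (F : (ZMod 3)⟦X⟧) : F ^ 3 = expand 3 three_ne_zero F := by
  rw [PowerSeries.expand]
  refine (MvPowerSeries.map_frobenius_expand 3 three_ne_zero (f := F)).symm.trans ?_
  rw [ZMod.frobenius_zmod, MvPowerSeries.map_id]
  rfl

theorem sum_mul_sum_cube_thetaTerm (z : (ZMod 3)⟦X⟧) (N : ℕ) :
    (∑ k ∈ Finset.Icc (-N : ℤ) N, thetaTerm z z k) *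
      (∑ k ∈ Finset.Icc (-N : ℤ) N, thetaTerm z z k) ^ 3 =
    ∑ p ∈ Finset.Icc (-N : ℤ) N ×ˢ Finset.Icc (-N : ℤ) N,
      z ^ (p.1.natAbs ^ 2 + 3 * p.2.natAbs ^ 2) := by
  have := charP_powerSeries_zmod_three
  rw [sum_pow_char 3, Finset.sum_mul_sum, Finset.sum_product]
  refine Finset.sum_congr rfl fun x _ => Finset.sum_congr rfl fun y _ => ?_
  rw [thetaTerm_self, thetaTerm_self, pow_add, ← pow_mul, mul_comm 3]

theorem coeff_thetaSeries_pow_four {z : (ZMod 3)⟦X⟧} (hz : X ∣ z) (n : ℕ) :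
    coeff n (thetaSeries z z ^ 4) =
      ∑ p ∈ Finset.Icc (-n : ℤ) n ×ˢ Finset.Icc (-n : ℤ) n,
        coeff n (z ^ (p.1.natAbs ^ 2 + 3 * p.2.natAbs ^ 2)) := by
  have h := X_pow_dvd_thetaSeries_sub hz hz n
  have h4 := h.trans (sub_dvd_pow_sub_pow _ _ 4)
  have := X_pow_dvd_iff.mp h4 n (by omega)
  rw [map_sub, sub_eq_zero] at this
  rw [this, ← map_sum, ← sum_mul_sum_cube_thetaTerm]
  ring_nf

theorem thetaSeries_pow_four_add :
    thetaSeries (X : (ZMod 3)⟦X⟧) X ^ 4 + thetaSeries (-X : (ZMod 3)⟦X⟧) (-X) ^ 4 = -1 := by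
  ext n
  rw [map_add, coeff_thetaSeries_pow_four dvd_rfl, coeff_thetaSeries_pow_four dvd_rfl.neg_right,
    ← Finset.sum_add_distrib]
  -- The factor 1 + (-1)^n removes odd `n`, leaving only the even ones to be counted.
  have hterm : ∀ e : ℕ, coeff n ((X : (ZMod 3)⟦X⟧) ^ e) + coeff n ((-X : (ZMod 3)⟦X⟧) ^ e) =
      (1 + (-1) ^ n) * if e = n then 1 else 0 := by
    intro e
    rw [neg_pow, ← map_one (C (R := ZMod 3)), ← map_neg, ← map_pow, coeff_C_mul, coeff_X_pow]
    by_cases h : e = n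
    · simp [h]
    · simp [h, Ne.symm h]
  simp only [hterm]
  rw [← Finset.mul_sum, ← Finset.sum_filter, Finset.sum_const, nsmul_one]
  rcases Nat.eq_zero_or_pos n with rfl | h0
  · simp
    decide
  rcases Nat.even_or_odd n with hn | hn
  · have hcard := three_dvd_card_sq_add_three_mul_sq hn h0
      (Finset.filter (fun p : ℤ × ℤ => p.1.natAbs ^ 2 + 3 * p.2.natAbs ^ 2 = n)
        (Finset.Icc (-n : ℤ) n ×ˢ Finset.Icc (-n : ℤ) n)) (fun p => by
        have hp : p.1.natAbs ^ 2 + 3 * p.2.natAbs ^ 2 = n ↔ p.1 ^ 2 + 3 * p.2 ^ 2 = n := by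
          zify
          simp only [sq_abs]
        rw [Finset.mem_filter, hp, and_iff_right_iff_imp, ← hp]
        intro h
        have h1 : p.1.natAbs ≤ p.1.natAbs ^ 2 := Nat.le_self_pow two_ne_zero _
        have h2 : p.2.natAbs ≤ p.2.natAbs ^ 2 := Nat.le_self_pow two_ne_zero _
        simp only [Finset.mem_product, Finset.mem_Icc]
        omega)
    rw [(ZMod.natCast_eq_zero_iff _ _).mpr hcard]
    simp [coeff_one, h0.ne']
  · simp [hn.neg_one_pow, coeff_one, h0.ne']

end modThree

/-! ### Dissection of the generating function modulo 3 -/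

section modThree

theorem exists_of_coeff_mul_ne_zero {R : Type*} [CommRing R] {F G : R⟦X⟧} {n : ℕ}
    (h : coeff n (F * G) ≠ 0) : ∃ i j, i + j = n ∧ coeff i F ≠ 0 ∧ coeff j G ≠ 0 := by
  rw [coeff_mul] at h
  obtain ⟨p, hp, hne⟩ := Finset.exists_ne_zero_of_sum_ne_zero h
  exact ⟨p.1, p.2, Finset.HasAntidiagonal.mem_antidiagonal.mp hp, left_ne_zero_of_mul hne,
    right_ne_zero_of_mul hne⟩

theorem coeff_three_mul_cube (F : (ZMod 3)⟦X⟧) (n : ℕ) : coeff (3 * n) (F ^ 3) = coeff n F := by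
  rw [cube_eq_expand, coeff_expand_mul]

theorem coeff_cube_of_not_dvd (F : (ZMod 3)⟦X⟧) {n : ℕ} (h : ¬ 3 ∣ n) : coeff n (F ^ 3) = 0 := by
  rw [cube_eq_expand, coeff_expand_of_not_dvd _ _ _ h]

theorem exists_of_coeff_cube_ne_zero {F : (ZMod 3)⟦X⟧} {n : ℕ} (h : coeff n (F ^ 3) ≠ 0) :
    ∃ i, n = 3 * i ∧ coeff i F ≠ 0 := by
  obtain ⟨i, rfl⟩ : 3 ∣ n := by
    by_contra hn
    exact h (coeff_cube_of_not_dvd F hn)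
  exact ⟨i, rfl, by rwa [coeff_three_mul_cube] at h⟩

theorem exists_of_coeff_thetaSeries_neg_X_ne_zero {n : ℕ}
    (h : coeff n (thetaSeries (-X : (ZMod 3)⟦X⟧) (-X)) ≠ 0) : ∃ k : ℤ, (n : ℤ) = k ^ 2 := by
  obtain ⟨k, hk⟩ := exists_of_coeff_thetaSeries_ne_zero (u := -1) (v := -1) (α := 1) (β := 1)
    (by simp) (by simp) h
  refine ⟨k, ?_⟩
  rw [one_mul, one_mul, triangular_pred_add] at hk
  rw [hk]
  simp

theorem exists_of_coeff_thetaSeries_neg_X_sq_ne_zero {n : ℕ}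
    (h : coeff n (thetaSeries (-X ^ 2 : (ZMod 3)⟦X⟧) (-X ^ 2)) ≠ 0) :
    ∃ k : ℤ, (n : ℤ) = 2 * k ^ 2 := by
  obtain ⟨k, hk⟩ := exists_of_coeff_thetaSeries_ne_zero (u := -1) (v := -1) (α := 2) (β := 2)
    (by simp) (by simp) h
  refine ⟨k, ?_⟩
  rw [← mul_add, triangular_pred_add] at hk
  rw [hk]
  simp

theorem exists_of_coeff_thetaSeries_neg_X_neg_X_cube_ne_zero {n : ℕ}
    (h : coeff n (thetaSeries (-X : (ZMod 3)⟦X⟧) (-X ^ 3)) ≠ 0) :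
    ∃ y : ℤ, 8 * (n : ℤ) + 1 = y ^ 2 := by
  obtain ⟨k, hk⟩ := exists_of_coeff_thetaSeries_ne_zero (u := -1) (v := -1) (α := 1) (β := 3)
    (by simp) (by simp) h
  refine ⟨4 * k + 1, ?_⟩
  have h₁ := two_mul_triangular (k - 1)
  have h₂ := two_mul_triangular k
  rw [hk]
  push_cast
  linear_combination 4 * h₁ + 12 * h₂

theorem exists_of_coeff_thetaSeries_neg_X_X_sq_ne_zero {n : ℕ}
    (h : coeff n (thetaSeries (-X : (ZMod 3)⟦X⟧) (X ^ 2)) ≠ 0) :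
    ∃ y : ℤ, 24 * (n : ℤ) + 1 = y ^ 2 := by
  obtain ⟨k, hk⟩ := exists_of_coeff_thetaSeries_ne_zero (u := -1) (v := 1) (α := 1) (β := 2)
    (by simp) (by simp) h
  refine ⟨6 * k + 1, ?_⟩
  have h₁ := two_mul_triangular (k - 1)
  have h₂ := two_mul_triangular k
  rw [hk]
  push_cast
  linear_combination 12 * h₁ + 24 * h₂

theorem distinctProd_mul_distinctProd_two :
    distinctProd (ZMod 3) 1 * distinctProd (ZMod 3) 2 =
      -(thetaSeries (-X) (-X) ^ 3 * thetaSeries (-X) (-X ^ 3)) -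
        (thetaSeries X X * distinctProd (ZMod 3) 1) ^ 3 * thetaSeries (-X ^ 2) (-X ^ 2) := by
  have hG := distinctProd_ne_zero (ZMod 3) two_pos
  have h₁ := thetaSeries_neg_X_pow (ZMod 3) one_pos
  have h₂ := thetaSeries_neg_X_pow (ZMod 3) two_pos
  have h₃ := thetaSeries_X (ZMod 3)
  have h₄ := thetaSeries_neg_X_neg_X_cube (ZMod 3)
  have h₅ := eulerProd_mul_distinctProd (ZMod 3) one_pos
  have h₆ := thetaSeries_pow_four_add
  rw [pow_one] at h₁
  rw [mul_one] at h₅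
  have h₇ : thetaSeries (X : (ZMod 3)⟦X⟧) X * distinctProd (ZMod 3) 2 =
      distinctProd (ZMod 3) 1 ^ 2 * thetaSeries (-X ^ 2) (-X ^ 2) :=
    mul_right_cancel₀ hG (by
      linear_combination h₃ - distinctProd (ZMod 3) 1 ^ 2 * h₂ + distinctProd (ZMod 3) 1 ^ 2 * h₅)
  rw [h₄]
  linear_combination (distinctProd (ZMod 3) 1 * distinctProd (ZMod 3) 2) * h₆ -
    thetaSeries (-X) (-X) ^ 3 * distinctProd (ZMod 3) 2 * h₁ -
    thetaSeries X X ^ 3 * distinctProd (ZMod 3) 1 * h₇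

/-- This evaluates the series that arises from the exponents divisible by 3 in the second summand;
both factors on the right have sparse support. -/
theorem thetaSeries_X_mul_distinctProd_mul :
    thetaSeries X X * distinctProd (ZMod 3) 1 * thetaSeries (-X ^ 2) (-X ^ 2) ^ 3 =
      thetaSeries (-X) (-X) * thetaSeries (-X) (X ^ 2) := by
  have hD := distinctProd_ne_zero (ZMod 3) one_pos
  have hG := distinctProd_ne_zero (ZMod 3) two_pos
  have h₁ := thetaSeries_neg_X_pow (ZMod 3) one_pos
  have h₂ := thetaSeries_neg_X_pow (ZMod 3) two_pos
  have h₃ := thetaSeries_X (ZMod 3)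
  have h₄ := thetaSeries_neg_X_X_sq (ZMod 3)
  have h₅ := eulerProd_mul_distinctProd (ZMod 3) one_pos
  rw [pow_one] at h₁
  rw [mul_one] at h₅
  rw [← h₅] at h₂
  refine mul_right_cancel₀ (pow_ne_zero 5 hG) (mul_right_cancel₀ hD ?_)
  calc _ = (thetaSeries X X * distinctProd (ZMod 3) 2 ^ 2) * distinctProd (ZMod 3) 1 ^ 2 *
        (thetaSeries (-X ^ 2) (-X ^ 2) * distinctProd (ZMod 3) 2) ^ 3 := by ring
    _ = eulerProd (ZMod 3) 1 * (eulerProd (ZMod 3) 1 ^ 3 * distinctProd (ZMod 3) 1 ^ 8) := by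
      rw [h₂, h₃]; ring
    _ = _ := by rw [← h₄]; nth_rw 1 [← h₁]; ring

theorem exists_of_coeff_first_ne_zero {m : ℕ}
    (h : coeff m (thetaSeries (-X : (ZMod 3)⟦X⟧) (-X) ^ 3 * thetaSeries (-X) (-X ^ 3)) ≠ 0) :
    ∃ x y : ℤ, 8 * (m : ℤ) + 1 = 24 * x ^ 2 + y ^ 2 := by
  obtain ⟨i, j, rfl, hi, hj⟩ := exists_of_coeff_mul_ne_zero h
  obtain ⟨i, rfl, hi'⟩ := exists_of_coeff_cube_ne_zero hi
  obtain ⟨x, hx⟩ := exists_of_coeff_thetaSeries_neg_X_ne_zero hi'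
  obtain ⟨y, hy⟩ := exists_of_coeff_thetaSeries_neg_X_neg_X_cube_ne_zero hj
  refine ⟨x, y, ?_⟩
  push_cast
  linear_combination 24 * hx + hy

/-- Since F³ involves only powers of q³, an exponent 2k² can contribute only if 3 ∣ k. Those terms
turn φ(-q²) into φ(-q^18), and q³ ↦ q then gives φ(-q^6), the cube of φ(-q²) modulo 3. -/
theorem coeff_three_mul_cube_mul_thetaSeries (F : (ZMod 3)⟦X⟧) (n : ℕ) :
    coeff (3 * n) (F ^ 3 * thetaSeries (-X ^ 2) (-X ^ 2)) =
      coeff n (F * thetaSeries (-X ^ 2) (-X ^ 2) ^ 3) := by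
  rw [← coeff_three_mul_cube (F * _), mul_pow, coeff_mul, coeff_mul]
  refine Finset.sum_congr rfl fun p hp => ?_
  rw [Finset.HasAntidiagonal.mem_antidiagonal] at hp
  by_cases h : 3 ∣ p.1
  · obtain ⟨j, hj⟩ : 3 ∣ p.2 := by omega
    rw [hj, coeff_three_mul_cube]
    by_cases h3 : 3 ∣ j
    · obtain ⟨i, rfl⟩ := h3
      rw [coeff_three_mul_cube, ← mul_assoc, show 3 * 3 * i = 9 * i from rfl,
        coeff_nine_mul_thetaSeries]
    · rw [coeff_cube_of_not_dvd _ h3]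
      congr 1
      by_contra hne
      obtain ⟨k, hk⟩ := exists_of_coeff_thetaSeries_neg_X_sq_ne_zero hne
      have h3k : (3 : ℤ) ∣ k := by
        refine Int.prime_three.dvd_of_dvd_pow (n := 2) ?_
        push_cast at hk
        omega
      obtain ⟨c, rfl⟩ := h3k
      rw [mul_pow] at hk
      push_cast at hk
      omega
  · rw [coeff_cube_of_not_dvd _ h, zero_mul, zero_mul]

theorem exists_of_coeff_second_ne_zero {m : ℕ} (hm : m % 3 ≠ 2)
    (h : coeff m ((thetaSeries X X * distinctProd (ZMod 3) 1) ^ 3 *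
      thetaSeries (-X ^ 2) (-X ^ 2)) ≠ 0) :
    ∃ x y : ℤ, 8 * (m : ℤ) + 1 = 24 * x ^ 2 + y ^ 2 := by
  have h01 : m % 3 = 0 ∨ m % 3 = 1 := by omega
  rcases h01 with h0 | h1
  · obtain ⟨n, rfl⟩ := Nat.dvd_of_mod_eq_zero h0
    rw [coeff_three_mul_cube_mul_thetaSeries, thetaSeries_X_mul_distinctProd_mul] at h
    obtain ⟨i, j, rfl, hi, hj⟩ := exists_of_coeff_mul_ne_zero h
    obtain ⟨x, hx⟩ := exists_of_coeff_thetaSeries_neg_X_ne_zero hi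
    obtain ⟨y, hy⟩ := exists_of_coeff_thetaSeries_neg_X_X_sq_ne_zero hj
    refine ⟨x, y, ?_⟩
    push_cast
    linear_combination 24 * hx + hy
  · obtain ⟨i, j, rfl, hi, hj⟩ := exists_of_coeff_mul_ne_zero h
    obtain ⟨i, rfl, -⟩ := exists_of_coeff_cube_ne_zero hi
    obtain ⟨k, hk⟩ := exists_of_coeff_thetaSeries_neg_X_sq_ne_zero hj
    have hj1 : (j : ℤ) % 3 = 1 := by omega
    have hk3 : k % 3 = 0 ∨ k % 3 = 1 ∨ k % 3 = 2 := by omega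
    rw [hk, pow_two] at hj1
    -- The value 2k² is 0 or 2 modulo 3, never 1.
    rcases hk3 with h | h | h <;> simp [Int.mul_emod, h] at hj1

end modThree

/-- A `4`-regular partition count that does not vanish modulo `3`, at an argument `m` not congruent
to `2` modulo `3`, forces a representation of `8 m + 1` by the form `24 x² + y²`. -/
theorem exists_of_card_restricted_four_not_dvd {m : ℕ} (hm : m % 3 ≠ 2)
    (h : ¬ 3 ∣ (Nat.Partition.restricted m (fun i => ¬ 4 ∣ i)).card) :
    ∃ x y : ℤ, 8 * (m : ℤ) + 1 = 24 * x ^ 2 + y ^ 2 := by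
  have hB := congrArg (coeff m) (mk_card_restricted_four (ZMod 3))
  rw [coeff_mk, distinctProd_mul_distinctProd_two, map_sub, map_neg] at hB
  rw [← ZMod.natCast_eq_zero_iff, hB] at h
  by_cases h₁ : coeff m (thetaSeries (-X : (ZMod 3)⟦X⟧) (-X) ^ 3 * thetaSeries (-X) (-X ^ 3)) = 0
  · rw [h₁, neg_zero, zero_sub, neg_eq_zero] at h
    exact exists_of_coeff_second_ne_zero hm h
  · exact exists_of_coeff_first_ne_zero h₁

/-! ### Divisibility of 24x² + y² by l -/

/-- The Legendre symbol of -2 depends on l mod 8, and that of 3 is found by quadratic reciprocity;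
in each of the four classes exactly one of them is -1. -/
theorem not_isSquare_neg_six {l : ℕ} [Fact l.Prime]
    (hmod : l % 24 = 13 ∨ l % 24 = 17 ∨ l % 24 = 19 ∨ l % 24 = 23) :
    ¬ IsSquare (-6 : ZMod l) := by
  have hl2 : l ≠ 2 := by rintro rfl; omega
  have h6 : (-6 : ZMod l) = (-2 : ℤ) * (3 : ℤ) := by push_cast; norm_num
  have h60 : (((-2 : ℤ) * 3 : ℤ) : ZMod l) ≠ 0 := by
    intro h0
    rw [ZMod.intCast_zmod_eq_zero_iff_dvd] at h0
    have h0' : l ∣ 6 := by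
      have := Int.natAbs_dvd_natAbs.mpr h0
      simpa using this
    have := Nat.le_of_dvd (by norm_num) h0'
    omega
  rw [h6, ← Int.cast_mul, ← legendreSym.eq_one_iff l h60, legendreSym.mul,
    legendreSym.at_neg_two hl2]
  have h3 : legendreSym l (3 : ℕ) = (-1) ^ (3 / 2 * (l / 2)) * legendreSym 3 l :=
    legendreSym.quadratic_reciprocity' (p := 3) (q := l) (by norm_num) hl2
  have hpar : ∀ r : ℕ, l / 2 % 2 = r % 2 → (-1 : ℤ) ^ (3 / 2 * (l / 2)) = (-1) ^ r := by
    intro r hr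
    rw [neg_one_pow_eq_pow_mod_two, neg_one_pow_eq_pow_mod_two (n := r)]
    congr 1
    omega
  have hleg : legendreSym 3 (l : ℤ) = legendreSym 3 ((l % 3 : ℕ) : ℤ) := by
    rw [legendreSym.mod 3 (l : ℤ)]
    norm_cast
  have hchi : ZMod.χ₈' (l : ZMod 8) = ZMod.χ₈' ((l % 8 : ℕ) : ZMod 8) := by
    rw [ZMod.natCast_mod]
  have hone : legendreSym 3 ((1 : ℕ) : ℤ) = 1 := by simp
  have htwo : legendreSym 3 ((2 : ℕ) : ℤ) = -1 := by
    rw [Nat.cast_ofNat, legendreSym.at_two (by norm_num)]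
    decide
  rw [show ((3 : ℤ)) = ((3 : ℕ) : ℤ) by norm_num, h3, hleg, hchi]
  rcases hmod with h | h | h | h
  · rw [hpar 0 (by omega), show l % 3 = 1 by omega, show l % 8 = 5 by omega,
      hone]
    decide
  · rw [hpar 0 (by omega), show l % 3 = 2 by omega, show l % 8 = 1 by omega,
      htwo]
    decide
  · rw [hpar 1 (by omega), show l % 3 = 1 by omega, show l % 8 = 3 by omega,
      hone]
    decide
  · rw [hpar 1 (by omega), show l % 3 = 2 by omega, show l % 8 = 7 by omega,
      htwo]
    decide

theorem sq_dvd_of_dvd_form {l : ℕ} [Fact l.Prime]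
    (hmod : l % 24 = 13 ∨ l % 24 = 17 ∨ l % 24 = 19 ∨ l % 24 = 23) {x y : ℤ}
    (h : (l : ℤ) ∣ 24 * x ^ 2 + y ^ 2) : (l : ℤ) ^ 2 ∣ 24 * x ^ 2 + y ^ 2 := by
  have hprime : Prime (l : ℤ) := Nat.prime_iff_prime_int.mp Fact.out
  have hx : (l : ℤ) ∣ x := by
    by_contra hx
    rw [← ZMod.intCast_zmod_eq_zero_iff_dvd] at hx h
    push_cast at h
    have h2 : (2 : ZMod l) ≠ 0 := by
      intro h2
      have : ((2 : ℕ) : ZMod l) = 0 := by exact_mod_cast h2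
      rw [ZMod.natCast_eq_zero_iff] at this
      have := Nat.le_of_dvd two_pos this
      omega
    -- From y² = -24x² modulo l, division by (2x)² gives -6.
    refine not_isSquare_neg_six hmod ⟨y / (2 * x), ?_⟩
    field_simp
    linear_combination -h
  have hy : (l : ℤ) ∣ y :=
    hprime.dvd_of_dvd_pow ((dvd_add_right ((dvd_pow hx two_ne_zero).mul_left 24)).mp h)
  exact dvd_add ((pow_dvd_pow_of_dvd hx 2).mul_left 24) (pow_dvd_pow_of_dvd hy 2)

theorem regularPartitionCount_four_modEq_zero {l : ℕ} (hl : l.Prime)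
    (hmod : l % 24 = 13 ∨ l % 24 = 17 ∨ l % 24 = 19 ∨ l % 24 = 23) {m : ℤ} (hm : m % 3 ≠ 2)
    (hdvd : (l : ℤ) ∣ 8 * m + 1) (hsq : ¬ (l : ℤ) ^ 2 ∣ 8 * m + 1) :
    regularPartitionCount 4 m ≡ 0 [MOD 3] := by
  have : Fact l.Prime := ⟨hl⟩
  rw [regularPartitionCount]
  split_ifs with h
  · obtain ⟨m, rfl⟩ := Int.eq_ofNat_of_zero_le h
    rw [Nat.modEq_zero_iff_dvd]
    by_contra hc
    obtain ⟨x, y, hxy⟩ := exists_of_card_restricted_four_not_dvd (by omega) hc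
    rw [Int.toNat_natCast] at hxy
    rw [hxy] at hdvd hsq
    exact hsq (sq_dvd_of_dvd_form hmod hdvd)
  · rfl

theorem not_sq_dvd_of_modulus {l : ℕ} (hl : l.Prime) (hl3 : 3 < l) {n j c : ℤ} (hj₁ : 1 ≤ j)
    (hj₂ : j ≤ (l : ℤ) - 1) : ¬ (l : ℤ) ^ 2 ∣ 24 * l * (l * n + j) + c * l ^ 2 := by
  intro h
  have h' : (l : ℤ) * l ∣ l * (24 * j) := by
    have : (l : ℤ) * (24 * j) =
        (24 * l * (l * n + j) + c * l ^ 2) - l ^ 2 * (24 * n + c) := by ring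
    rw [this, ← pow_two]
    exact dvd_sub h (dvd_mul_right _ _)
  have hprime : Prime (l : ℤ) := Nat.prime_iff_prime_int.mp hl
  rcases hprime.dvd_or_dvd ((mul_dvd_mul_iff_left hprime.ne_zero).mp h') with h24 | hj
  · have h24' : l ∣ 2 ^ 3 * 3 := by exact_mod_cast h24
    rcases (Nat.Prime.dvd_mul hl).mp h24' with h | h
    · have := Nat.le_of_dvd two_pos (hl.dvd_of_dvd_pow h)
      omega
    · have := Nat.le_of_dvd three_pos h
      omega
  · have := Int.le_of_dvd (by omega) hj
    omega

theorem theorem1p2 (l : ℕ) (hl : l.Prime)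
    (hmod : l ≡ 13 [MOD 24] ∨ l ≡ 17 [MOD 24] ∨ l ≡ 19 [MOD 24] ∨ l ≡ 23 [MOD 24])
    (n j : ℤ) (hj₁ : 1 ≤ j) (hj₂ : j ≤ (l : ℤ) - 1) :
    regularPartitionCount 4 (3 * l * (l * n + j) + ((l : ℤ) ^ 2 - 1) / 8) ≡ 0 [MOD 3] ∧
    regularPartitionCount 4 (3 * l * (l * n + j) + (9 * (l : ℤ) ^ 2 - 1) / 8) ≡ 0 [MOD 3] := by
  have hmod' : l % 24 = 13 ∨ l % 24 = 17 ∨ l % 24 = 19 ∨ l % 24 = 23 := hmod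
  -- Divisibility by 24 makes both quotients by 8 exact and shows the two arguments to be 0 and 1
  -- modulo 3, avoiding the excluded class 2.
  obtain ⟨t, ht⟩ : (24 : ℤ) ∣ (l : ℤ) ^ 2 - 1 := by
    apply Int.dvd_of_emod_eq_zero
    have h : (l : ℤ) % 24 = 13 ∨ (l : ℤ) % 24 = 17 ∨ (l : ℤ) % 24 = 19 ∨ (l : ℤ) % 24 = 23 := by
      omega
    rcases h with h | h | h | h <;> rw [pow_two, Int.sub_emod, Int.mul_emod, h] <;> rfl
  have e₁ : ((l : ℤ) ^ 2 - 1) / 8 = 3 * t := by omega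
  have e₂ : (9 * (l : ℤ) ^ 2 - 1) / 8 = 27 * t + 1 := by omega
  rw [e₁, e₂]
  have hN₁ : 8 * (3 * l * (l * n + j) + 3 * t) + 1 = 24 * l * (l * n + j) + 1 * (l : ℤ) ^ 2 := by
    linear_combination -ht
  have hN₂ : 8 * (3 * l * (l * n + j) + (27 * t + 1)) + 1 =
      24 * l * (l * n + j) + 9 * (l : ℤ) ^ 2 := by
    linear_combination -9 * ht
  have hdvd : ∀ c : ℤ, (l : ℤ) ∣ 24 * l * (l * n + j) + c * l ^ 2 := fun c =>
    ⟨24 * (l * n + j) + c * l, by ring⟩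
  constructor
  · refine regularPartitionCount_four_modEq_zero hl hmod' ?_ ?_ ?_
    · rw [mul_assoc]; omega
    · rw [hN₁]; exact hdvd 1
    · rw [hN₁]; exact not_sq_dvd_of_modulus hl (by omega) hj₁ hj₂
  · refine regularPartitionCount_four_modEq_zero hl hmod' ?_ ?_ ?_
    · rw [mul_assoc]; omega
    · rw [hN₂]; exact hdvd 9
    · rw [hN₂]; exact not_sq_dvd_of_modulus hl (by omega) hj₁ hj₂
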